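/- **Setting.** Let $\Sigma$ be a finite alphabet. A *computation graph* $G_n$ with $n$ inputs and $m$ outputs is a finite directed acyclic graph with exactly $n$ input nodes (of in-degree $0$, the $i$-th one carrying the input symbol $x_i$). Every other node $v$ carries a local function $f_v:\Sigma^{\ell_v}\to\Sigma$, where $\ell_v$ is the in-degree of $v$ and the predecessors of $v$ are ordered. There are $m$ distinct designated output nodes, of out-degree $0$. Evaluation in topological order assigns a symbol $v(x)\in\Sigma$ to each node $v$ and defines $G_n:\Sigma^n\to\Sigma^m$. The size of $G_n$ is its number of nodes. Its depth, $\mathrm{depth}(G_n)$, is the length of the longest path from an input node to an output node ($0$ if there is none). The depth of a node $v$ is the maximal length of a path ending in $v$, and $L_\ell$ is the set of nodes of depth $\ell$. Put $$\widehat L_\ell := L_\ell\cup\bigcup_{v\in L_s,\ s>\ell}\Big(\mathrm{Pred}(v)\cap\bigcup_{s\le \ell}L_s\Big).$$ These are the nodes having a copy in layer $\ell$ of the strict layered expansion of $G_n$, in which each edge $u\to v$ is replaced by a path of identity copies of $u$ through the layers between $u$ and $v$. The parallel space complexity is $S(G_n)=\max_{\ell}|\widehat L_\ell|$, the maximum being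 over $0\le \ell\le \max_v \mathrm{depth}(v)$. $\mathbb Q_p$ denotes the fixed-point numbers $k/2^p$ with $k\in\mathbb Z$, $|k|\le 2^{2p}-1$. Each arithmetic operation on $\mathbb Q_p$ (a sum, an inner product, each coordinate of a matrix-vector product, an average) is evaluated and then truncated to $\mathbb Q_p$: rounded towards $0$, and saturated on overflow. A precision $p(n)$ is *logarithmic* if $p(n)\in O(\log n)$. A function $f:\mathbb N\to\mathbb N$ is in $\mathrm{poly}(n)$ if there are constants $k,c$ with $f(n)\le c\,n^k$ for all $n\ge 1$. A *Looped Transformer* with precision $p$ and embedding dimension $d$ consists of a word embedding $\mathbf{WE}:\Sigma\to\mathbb Q_p^d$, a positional embedding $\mathbf{PE}(i,k)\in\mathbb Q_p^d$ (position $i$, loop $k$), a block $$f=(\mathrm{id}+\mathbf{FF}_L)\circ(\mathrm{id}+\mathbf{SA}_L)\circ\cdots\circ(\mathrm{id}+\mathbf{FF}_1)\circ(\mathrm{id}+\mathbf{SA}_1),$$ and a linear output map $\gamma:\mathbb Q_p^d\to\mathbb Q_p^{\Sigma}$. Here $\mathbf{SA}_\ell$ is non-causal multi-head self-attention with saturated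 attention (uniform weights on the positions of highest score). $\mathbf{FF}_\ell$ is either $z\mapsto W_2\,\mathrm{ReLU}(W_1z)$ or a mixture of such experts, the expert being the $\arg\max$ of a linear gate. On input $x\in\Sigma^n$ the hidden states are $f^0(x)=(\mathbf{WE}(x_1),\dots,\mathbf{WE}(x_n))$ and $f^{k+1}(x)=f\big(f^k(x)+\mathbf{PE}(\cdot,k)\big)$. The output after $T$ loops is the word of the last $m\le n$ positions of $\arg\max\gamma\big(f^{T}(x)\big)$, each of these maxima being attained at one symbol only. The *parameter size* is the number of scalar parameters, including the $n\cdot T$ vectors of the positional embedding that are used. **Theorem (Looped TF for DAGs).** Let $m:\mathbb N\to\mathbb N$ and let $\{G_n\}_{n\in\mathbb N}$ be a family of computation graphs over $\Sigma$ of size $\mathrm{poly}(n)$, with $G_n:\Sigma^n\to\Sigma^{m(n)}$. Assume: 1. (Polynomially-efficient approximation) There are a logarithmic precision $p'(n)$ and a width $w(n)\in\mathrm{poly}(n)$ such that for each $n$ and each local function $g:\Sigma^\ell\to\Sigma$ of $G_n$ there are matrices $W_1\in\mathbb Q_{p'(n)}^{w(n)\times \ell|\Sigma|}$ and $W_2\in\mathbb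 Q_{p'(n)}^{|\Sigma|\times w(n)}$ with the following property. For every $y\in\Sigma^\ell$, the vector $\hat y=W_2\,\mathrm{ReLU}(W_1\,\mathrm{emb}(y))$, with $\mathrm{emb}(y)$ the concatenated one-hot encodings of $y_1,\dots,y_\ell$, satisfies $\hat y_{g(y)}>1-\delta$ and $\hat y_s<1-\delta$ for all $s\neq g(y)$, for some $\delta>0$. 2. (Bounded fan-in) There is a constant $k$ such that all in-degrees in all $G_n$ are at most $k$. 3. (Linear parallel space) $S(G_n)\in O(n)$. 4. (Output bound) $m(n)\le n$ for all $n$. Then there are a number $L$ not depending on $n$, a logarithmic precision $p(n)$, and for each $n$ a Looped Transformer $M_n$ with precision $p(n)$ and $L$ layers in its block, such that, with $$T(n)=\max\{1,\mathrm{depth}(G_n)\},$$ the parameter size of $M_n$ is in $\mathrm{poly}(n)$ and, for every $n$ and every $x\in\Sigma^n$, the output of $M_n$ on $x$ after $T(n)$ loops is $G_n(x)$. Moreover, $M_n$ evaluates one layer of the strict layered expansion per loop: for every $n\ge1$, every $t\le\mathrm{depth}(G_n)$ and every node $u\in\widehat L_t$ there are a position $i\le n$ and a block of $|\Sigma|$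 coordinates, indexed by $\Sigma$ and not depending on $x$, such that for every $x\in\Sigma^n$ the unique $\arg\max$ of this block of the $i$-th column of $f^t(x)$ is $u(x)$. -/

import Mathlib

/-! ## Growth rates -/

/-- `f (n) ∈ poly (n)`. -/
def IsPolyBounded (f : ℕ → ℕ) : Prop :=
  ∃ k c : ℕ, ∀ n, 1 ≤ n → f n ≤ c * n ^ k

/-- `f (n) ∈ O (g (n))` for functions on the natural numbers. -/
def IsBigONat (f g : ℕ → ℕ) : Prop :=
  ∃ c n₀ : ℕ, ∀ n, n₀ ≤ n → f n ≤ c * g n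

/-- A bit precision is logarithmic if `p (n) ∈ O (⌈log₂ n⌉)`. -/
def IsLogPrecision (p : ℕ → ℕ) : Prop :=
  IsBigONat p (fun n => Nat.clog 2 n)

/-! ## Fixed-point numbers with truncated arithmetic -/

/-- Fixed-point numbers with a sign, `p` integer bits and `p` fractional bits:
the numbers `k / 2 ^ p` with `|k| ≤ 2 ^ (2 * p) - 1`. -/
def FixedPoint (p : ℕ) : Type :=
  {x : ℚ // ∃ k : ℤ, |k| ≤ 2 ^ (2 * p) - 1 ∧ x = k / 2 ^ p}

namespace FixedPoint

/-- The rational number represented by a fixed-point number. -/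
def toRat {p : ℕ} (x : FixedPoint p) : ℚ := x.1

/-- The numerator used by `trunc`: `|x| * 2 ^ p` rounded down and cut off at the largest
representable value, with the sign of `x`. -/
def truncNum (p : ℕ) (x : ℚ) : ℤ :=
  (SignType.sign x : ℤ) * min ⌊|x| * 2 ^ p⌋ (2 ^ (2 * p) - 1)

theorem abs_truncNum_le (p : ℕ) (x : ℚ) : |truncNum p x| ≤ 2 ^ (2 * p) - 1 := by
  have hB : (0 : ℤ) ≤ 2 ^ (2 * p) - 1 := by
    have : (1 : ℤ) ≤ 2 ^ (2 * p) := one_le_pow₀ (by norm_num)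
    linarith
  have hf : (0 : ℤ) ≤ ⌊|x| * 2 ^ p⌋ := Int.floor_nonneg.mpr (by positivity)
  have h0 : (0 : ℤ) ≤ min ⌊|x| * 2 ^ p⌋ (2 ^ (2 * p) - 1) := le_min hf hB
  have h1 : min ⌊|x| * 2 ^ p⌋ ((2 : ℤ) ^ (2 * p) - 1) ≤ 2 ^ (2 * p) - 1 := min_le_right _ _
  unfold truncNum
  rcases lt_trichotomy x 0 with h | h | h
  · simp only [sign_neg h, SignType.coe_neg_one, neg_one_mul, abs_neg]
    rwa [abs_of_nonneg h0]
  · subst h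
    simpa using hB
  · simp only [sign_pos h, SignType.coe_one, one_mul]
    rwa [abs_of_nonneg h0]

/-- Truncation to the `p`-bit fixed-point format (towards zero, saturating on overflow).
Every arithmetic operation of the models below is evaluated and then truncated. -/
def trunc (p : ℕ) (x : ℚ) : FixedPoint p :=
  ⟨truncNum p x / 2 ^ p, truncNum p x, abs_truncNum_le p x, rfl⟩

/-- Truncated addition. -/
def add {p : ℕ} (x y : FixedPoint p) : FixedPoint p := trunc p (x.toRat + y.toRat)

/-- The rectifier `max x 0`. -/
def relu {p : ℕ} (x : FixedPoint p) : FixedPoint p := trunc p (max x.toRat 0)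

/-- Matrix-vector product; each coordinate is truncated. -/
def mulVec {p : ℕ} {ι κ : Type*} [Fintype κ] (A : Matrix ι κ (FixedPoint p))
    (z : κ → FixedPoint p) (i : ι) : FixedPoint p :=
  trunc p (∑ j, (A i j).toRat * (z j).toRat)

/-- Inner product, truncated. -/
def inner {p : ℕ} {κ : Type*} [Fintype κ] (y z : κ → FixedPoint p) : FixedPoint p :=
  trunc p (∑ j, (y j).toRat * (z j).toRat)

/-- `z ↦ W₂ ReLU (W₁ z)`. -/
def twoLayer {p : ℕ} {ι κ η : Type*} [Fintype κ] [Fintype η]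
    (W₁ : Matrix η κ (FixedPoint p)) (W₂ : Matrix ι η (FixedPoint p))
    (z : κ → FixedPoint p) : ι → FixedPoint p :=
  mulVec W₂ (fun e => relu (mulVec W₁ z e))

/-- `s` is the (unique) arg max of the scores `z`. -/
def IsArgmax {p : ℕ} {ι : Type*} (z : ι → FixedPoint p) (s : ι) : Prop :=
  ∀ s', s' ≠ s → (z s').toRat < (z s).toRat

/-- The arg max of a non-empty list of scores; ties are resolved by the least index. -/
def argmax {p N : ℕ} (z : Fin (N + 1) → FixedPoint p) : Fin (N + 1) :=
  (Finset.univ.filter fun e => ∀ e', (z e').toRat ≤ (z e).toRat).min' (by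
    obtain ⟨e, he⟩ := Finite.exists_max fun e => (z e).toRat
    exact ⟨e, by simpa using he⟩)

end FixedPoint

/-! ## Computation graphs -/

/-- The edge relation on the vertices `Fin n ⊕ N` given by ordered argument lists of the
function nodes: there is an edge from `u` to `v` if `u` is an argument of `v`. -/
def ArgEdge {n : ℕ} {N : Type} {arity : N → ℕ}
    (args : (a : N) → Fin (arity a) → Fin n ⊕ N) (u v : Fin n ⊕ N) : Prop :=
  ∃ (a : N) (i : Fin (arity a)), v = Sum.inr a ∧ u = args a i

/-- A computation graph over the alphabet `S` with `n` inputs and `m` outputs.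
The vertices are the `n` input nodes (`Sum.inl i`, of in-degree 0) and the function nodes
(`Sum.inr a`). The node `a` carries a local function on `arity a` symbols, and its predecessors
are listed without repetition by `args a`, so that its in-degree is the arity. The set of local
functions is the set of all `func a`. -/
structure ComputationGraph (S : Type*) (n m : ℕ) where
  /-- The function nodes. -/
  N : Type
  [fintypeN : Fintype N]
  arity : N → ℕ
  func : (a : N) → (Fin (arity a) → S) → S
  args : (a : N) → Fin (arity a) → Fin n ⊕ N
  args_injective : ∀ a, Function.Injective (args a)
  acyclic : ∀ v, ¬ Relation.TransGen (ArgEdge args) v v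
  output : Fin m → Fin n ⊕ N
  output_injective : Function.Injective output
  /-- Output nodes have out-degree 0. -/
  output_sink : ∀ j v, ¬ ArgEdge args (output j) v

namespace ComputationGraph

variable {S : Type*} {n m : ℕ}

attribute [instance] ComputationGraph.fintypeN

/-- The vertices. -/
abbrev V (G : ComputationGraph S n m) : Type := Fin n ⊕ G.N

/-- The edge relation. -/
def Edge (G : ComputationGraph S n m) : G.V → G.V → Prop := ArgEdge G.args

theorem edge_wellFounded (G : ComputationGraph S n m) : WellFounded G.Edge := by
  have : Std.Irrefl (Relation.TransGen G.Edge) := ⟨G.acyclic⟩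
  have hT : WellFounded (Relation.TransGen G.Edge) :=
    Finite.wellFounded_of_trans_of_irrefl _
  exact Subrelation.wf (fun h => Relation.TransGen.single h) hT

/-- The symbol computed at each node on input `x`, by evaluation in topological order. -/
def eval (G : ComputationGraph S n m) (x : Fin n → S) : G.V → S :=
  G.edge_wellFounded.fix fun v ih =>
    match v, ih with
    | Sum.inl i, _ => x i
    | Sum.inr a, ih => G.func a fun i => ih (G.args a i) ⟨a, i, rfl, rfl⟩

theorem eval_input (G : ComputationGraph S n m) (x : Fin n → S) (i : Fin n) :
    G.eval x (Sum.inl i) = x i := by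
  rw [eval, WellFounded.fix_eq]

theorem eval_node (G : ComputationGraph S n m) (x : Fin n → S) (a : G.N) :
    G.eval x (Sum.inr a) = G.func a fun i => G.eval x (G.args a i) := by
  rw [eval, WellFounded.fix_eq]

/-- The function from `S ^ n` to `S ^ m` defined by the graph. -/
def compute (G : ComputationGraph S n m) (x : Fin n → S) : Fin m → S :=
  fun j => G.eval x (G.output j)

/-- The number of nodes. -/
def size (G : ComputationGraph S n m) : ℕ := Fintype.card G.V

/-- The predecessors of a node. -/
def Pred (G : ComputationGraph S n m) (v : G.V) : Set G.V := {u | G.Edge u v}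

/-- The in-degree of a node. -/
noncomputable def inDegree (G : ComputationGraph S n m) (v : G.V) : ℕ := (G.Pred v).ncard

/-- `w` is a directed path with `l` edges. -/
def IsPath (G : ComputationGraph S n m) (l : ℕ) (w : Fin (l + 1) → G.V) : Prop :=
  ∀ i : Fin l, G.Edge (w i.castSucc) (w i.succ)

theorem IsPath.length_le {G : ComputationGraph S n m} {l : ℕ} {w : Fin (l + 1) → G.V}
    (h : G.IsPath l w) : l ≤ G.size := by
  have key : ∀ i j : Fin (l + 1), i < j → Relation.TransGen G.Edge (w i) (w j) := by
    intro i j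
    induction j using Fin.induction with
    | zero => intro hij; exact absurd hij (Fin.not_lt_zero i)
    | succ j ih =>
      intro hij
      rcases (Fin.le_castSucc_iff.mpr hij).eq_or_lt with e | e
      · rw [e]; exact Relation.TransGen.single (h j)
      · exact (ih e).tail (h j)
  have inj : Function.Injective w := by
    intro i j hij
    rcases lt_trichotomy i j with e | e | e
    · exact absurd (hij ▸ key i j e) (G.acyclic _)
    · exact e
    · exact absurd (hij ▸ key j i e) (G.acyclic _)
  have := Fintype.card_le_of_injective w inj
  simp only [Fintype.card_fin] at this
  unfold size
  omega

/-- The depth of a node: the maximal length of a path that ends in it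
(a maximum, by `IsPath.length_le`). -/
noncomputable def nodeDepth (G : ComputationGraph S n m) (v : G.V) : ℕ :=
  sSup {l | ∃ w, G.IsPath l w ∧ w (Fin.last l) = v}

/-- The depth of the graph: the length of the longest path from an input node to an output node
(and 0 if there is no such path). -/
noncomputable def depth (G : ComputationGraph S n m) : ℕ :=
  sSup {l | ∃ w, G.IsPath l w ∧ (∃ i, w 0 = Sum.inl i) ∧ ∃ j, w (Fin.last l) = G.output j}

/-- The layer `l` of the canonical layer decomposition. -/
def layer (G : ComputationGraph S n m) (l : ℕ) : Set G.V := {v | G.nodeDepth v = l}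

/-- The index of the last non-empty layer. -/
noncomputable def maxDepth (G : ComputationGraph S n m) : ℕ := Finset.univ.sup G.nodeDepth

/-- The nodes of layer `l`, together with the nodes of layers `≤ l` on which some node of a
layer `> l` depends. These are the nodes `u` that have a copy `u ^ (l)` in layer `l` of the strict
layered expansion of the graph, where every edge `u → v` is replaced by the path
`u ^ (d_u) → u ^ (d_u + 1) → ⋯ → u ^ (d_v - 1) → v ^ (d_v)` of identity copies. -/
def expandedLayer (G : ComputationGraph S n m) (l : ℕ) : Set G.V :=
  G.layer l ∪ ⋃ v ∈ ⋃ s > l, G.layer s, G.Pred v ∩ ⋃ s ≤ l, G.layer s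

/-- The parallel space complexity. -/
noncomputable def parallelSpace (G : ComputationGraph S n m) : ℕ :=
  (Finset.range (G.maxDepth + 1)).sup fun l => (G.expandedLayer l).ncard

end ComputationGraph

/-! ## Assumptions on families of computation graphs -/

/-- The concatenation of the one-hot encodings of the symbols of a word. -/
def oneHotWord (p : ℕ) {S : Type*} [DecidableEq S] {l : ℕ} (y : Fin l → S) :
    Fin l × S → FixedPoint p :=
  fun is => FixedPoint.trunc p (if y is.1 = is.2 then 1 else 0)

/-- The local function `f` is approximated by a two-layer network of width `w` and precision
`p`: on every word, the score of the correct symbol is above a threshold `1 - δ`, and all other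
scores are below it. -/
def ApproximatedBy {S : Type*} [Fintype S] [DecidableEq S] {l : ℕ} (f : (Fin l → S) → S)
    (p w : ℕ) : Prop :=
  ∃ (W₁ : Matrix (Fin w) (Fin l × S) (FixedPoint p)) (W₂ : Matrix S (Fin w) (FixedPoint p)),
    ∀ y : Fin l → S, ∃ δ : ℚ, 0 < δ ∧
      1 - δ < (FixedPoint.twoLayer W₁ W₂ (oneHotWord p y) (f y)).toRat ∧
      ∀ s, s ≠ f y → (FixedPoint.twoLayer W₁ W₂ (oneHotWord p y) s).toRat < 1 - δ

/-- All local functions of the family are polynomially-efficiently approximated: polynomial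
width and logarithmic precision. -/
def PolyEfficientlyApproximated {S : Type*} [Fintype S] [DecidableEq S] {m : ℕ → ℕ}
    (G : (n : ℕ) → ComputationGraph S n (m n)) : Prop :=
  ∃ p w : ℕ → ℕ, IsLogPrecision p ∧ IsPolyBounded w ∧
    ∀ n, ∀ a : (G n).N, ApproximatedBy ((G n).func a) (p n) (w n)

/-- The fan-in is bounded by a constant. -/
def BoundedFanIn {S : Type*} {m : ℕ → ℕ} (G : (n : ℕ) → ComputationGraph S n (m n)) : Prop :=
  ∃ k : ℕ, ∀ n, ∀ v : (G n).V, (G n).inDegree v ≤ k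

/-! ## Looped Transformers -/

/-- Multi-head self-attention on embedding dimension `d` with precision `p`. -/
structure SelfAttention (p d : ℕ) where
  heads : ℕ
  headDim : ℕ
  Q : Fin heads → Matrix (Fin headDim) (Fin d) (FixedPoint p)
  K : Fin heads → Matrix (Fin headDim) (Fin d) (FixedPoint p)
  V : Fin heads → Matrix (Fin headDim) (Fin d) (FixedPoint p)
  W : Matrix (Fin d) (Fin heads × Fin headDim) (FixedPoint p)

namespace SelfAttention

variable {p d : ℕ}

/-- The attention score between the query at position `i` and the key at position `j`. -/
def score (A : SelfAttention p d) {n : ℕ} (z : Fin n → Fin d → FixedPoint p)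
    (h : Fin A.heads) (i j : Fin n) : FixedPoint p :=
  FixedPoint.inner (FixedPoint.mulVec (A.Q h) (z i)) (FixedPoint.mulVec (A.K h) (z j))

/-- The positions with the highest score. -/
def top (A : SelfAttention p d) {n : ℕ} (z : Fin n → Fin d → FixedPoint p)
    (h : Fin A.heads) (i : Fin n) : Finset (Fin n) :=
  Finset.univ.filter fun j => ∀ k, (A.score z h i k).toRat ≤ (A.score z h i j).toRat

/-- Saturated attention: the average of the values over the positions with the highest score. -/
def head (A : SelfAttention p d) {n : ℕ} (z : Fin n → Fin d → FixedPoint p)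
    (i : Fin n) (hc : Fin A.heads × Fin A.headDim) : FixedPoint p :=
  FixedPoint.trunc p
    ((∑ j ∈ A.top z hc.1 i, (FixedPoint.mulVec (A.V hc.1) (z j) hc.2).toRat) /
      (A.top z hc.1 i).card)

/-- The (non-causal) attention layer. -/
def apply (A : SelfAttention p d) {n : ℕ} (z : Fin n → Fin d → FixedPoint p) :
    Fin n → Fin d → FixedPoint p :=
  fun i => FixedPoint.mulVec A.W (A.head z i)

/-- The number of scalar parameters. -/
def paramCount (A : SelfAttention p d) : ℕ := 4 * (A.heads * A.headDim * d)

end SelfAttention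

/-- A feedforward layer: a standard two-layer network of width `w`, or a mixture of `N + 1` such
experts, one of which is selected by the arg max of a linear gate. -/
inductive FeedForward (p d : ℕ) where
  | dense (w : ℕ) (W₁ : Matrix (Fin w) (Fin d) (FixedPoint p))
      (W₂ : Matrix (Fin d) (Fin w) (FixedPoint p)) : FeedForward p d
  | moe (N w : ℕ) (W₁ : Fin (N + 1) → Matrix (Fin w) (Fin d) (FixedPoint p))
      (W₂ : Fin (N + 1) → Matrix (Fin d) (Fin w) (FixedPoint p))
      (gate : Matrix (Fin (N + 1)) (Fin d) (FixedPoint p)) : FeedForward p d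

namespace FeedForward

variable {p d : ℕ}

/-- The layer as a function of the embedding at one position. -/
def apply : FeedForward p d → (Fin d → FixedPoint p) → Fin d → FixedPoint p
  | dense _ W₁ W₂, z => FixedPoint.twoLayer W₁ W₂ z
  | moe _ _ W₁ W₂ gate, z =>
      let e := FixedPoint.argmax (FixedPoint.mulVec gate z)
      FixedPoint.twoLayer (W₁ e) (W₂ e) z

/-- The number of scalar parameters. -/
def paramCount : FeedForward p d → ℕ
  | dense w _ _ => 2 * (w * d)
  | moe N w _ _ _ => (N + 1) * (2 * (w * d)) + (N + 1) * d

end FeedForward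

/-- A Looped Transformer over the vocabulary `S`, with all parameters in the `p`-bit fixed-point
format: embedding dimension, word embedding, loop-dependent positional embedding
(position, loop), the layers of the block (first layer first), and the linear output function. -/
structure LoopedTF (S : Type*) (p : ℕ) where
  d : ℕ
  WE : S → Fin d → FixedPoint p
  PE : ℕ → ℕ → Fin d → FixedPoint p
  layers : List (SelfAttention p d × FeedForward p d)
  γ : Matrix S (Fin d) (FixedPoint p)

namespace LoopedTF

variable {S : Type*} {p : ℕ}

/-- One layer: `(id + FF) ∘ (id + SA)`. -/
def layerMap {d n : ℕ} (l : SelfAttention p d × FeedForward p d)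
    (z : Fin n → Fin d → FixedPoint p) : Fin n → Fin d → FixedPoint p :=
  let y : Fin n → Fin d → FixedPoint p := fun i c => (z i c).add (l.1.apply z i c)
  fun i c => (y i c).add (l.2.apply (y i) c)

/-- The Transformer block, the composition of all layers. -/
def block (M : LoopedTF S p) {n : ℕ} (z : Fin n → Fin M.d → FixedPoint p) :
    Fin n → Fin M.d → FixedPoint p :=
  M.layers.foldl (fun y l => layerMap l y) z

/-- The hidden state after `k` loops. -/
def state (M : LoopedTF S p) {n : ℕ} (x : Fin n → S) : ℕ → Fin n → Fin M.d → FixedPoint p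
  | 0 => fun i => M.WE (x i)
  | k + 1 => M.block fun i c => (M.state x k i c).add (M.PE i k c)

/-- After `T` loops, the arg max of the linear output function at the last `m ≤ n` positions is
the word `y`. -/
def Outputs (M : LoopedTF S p) {n m : ℕ} (h : m ≤ n) (T : ℕ) (x : Fin n → S)
    (y : Fin m → S) : Prop :=
  ∀ j : Fin m,
    FixedPoint.IsArgmax (FixedPoint.mulVec M.γ (M.state x T ⟨n - m + j, by omega⟩)) (y j)

/-- The number of scalar parameters of a model that is run for `T` loops on inputs of length `n`.
The table of the positional embedding, for `n` positions and `T` loops, is included. -/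
def paramSize (M : LoopedTF S p) [Fintype S] (n T : ℕ) : ℕ :=
  Fintype.card S * M.d + n * T * M.d +
    (M.layers.map fun l => l.1.paramCount + l.2.paramCount).sum + Fintype.card S * M.d

end LoopedTF

/-! ## Exact integer arithmetic in the fixed-point format -/

namespace FixedPoint

/-! Every position carries the symbols of all function nodes, one-hot encoded, so the embedding
dimension is polynomial and one loop can be a synchronous update of the whole graph (`sweep`). In a
loop, attention copies the input word into a buffer at every position. The first feedforward layer
then evaluates all local functions by lookup: for each node and each argument word `y`, one
rectified unit fires exactly when the stored arguments are `y`. The second writes the symbol of the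
output node assigned to the position and empties the buffer. Bounded fan-in keeps the tables
polynomial (`card_entry_le`).

At loop boundaries and between layers all coordinates are 0 or 1, and all weights and
pre-activations are integers bounded in terms of the fan-in. Truncated arithmetic is therefore exact
at a constant precision, and each layer reduces to an identity over the integers
(`updateFF_residual`, `copySA_residual`). Chaining these identities gives the state after every loop
(`loopedTF_state`).

After `t` updates a node is correct as soon as every path from an input to it has length at most `t`
(`sweep_eq_eval`). Nodes that no input reaches may sit at the end of long paths which `depth` does
not count. They are constant, and are correct from the start because the word embedding initializes
the function nodes with a genuine evaluation, on a constant word. -/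

theorem toRat_trunc_int {p : ℕ} {k : ℤ} (hk : |k| ≤ p) : (trunc p (k : ℚ)).toRat = k := by
  have hp : (p : ℤ) + 1 ≤ 2 ^ p := by exact_mod_cast Nat.lt_two_pow_self (n := p)
  have hle : |k| * 2 ^ p ≤ 2 ^ (2 * p) - 1 := by
    -- No overflow: `|k| * 2 ^ p ≤ (2 ^ p - 1) * 2 ^ p ≤ 2 ^ (2 * p) - 1`.
    have h2 : (2 : ℤ) ^ (2 * p) = 2 ^ p * 2 ^ p := by rw [two_mul, pow_add]
    rw [h2]
    nlinarith [abs_nonneg k]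
  have hfl : ⌊|(k : ℚ)| * 2 ^ p⌋ = |k| * 2 ^ p := by
    have : |(k : ℚ)| * 2 ^ p = ((|k| * 2 ^ p : ℤ) : ℚ) := by push_cast; rfl
    rw [this, Int.floor_intCast]
  have hs : (SignType.sign (k : ℚ) : ℤ) = SignType.sign k := by
    rcases lt_trichotomy k 0 with h | h | h
    · rw [sign_neg h, sign_neg (by exact_mod_cast h)]
    · simp [h]
    · rw [sign_pos h, sign_pos (by exact_mod_cast h)]
  have hnum : truncNum p (k : ℚ) = k * 2 ^ p := by
    rw [truncNum, hfl, min_eq_left hle, hs, ← mul_assoc, sign_mul_abs]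
  change ((truncNum p (k : ℚ) : ℚ)) / 2 ^ p = k
  rw [hnum]
  push_cast
  field_simp

theorem add_trunc_int {p : ℕ} {k l : ℤ} (hk : |k| ≤ p) (hl : |l| ≤ p) :
    (trunc p (k : ℚ)).add (trunc p (l : ℚ)) = trunc p ((k + l : ℤ) : ℚ) := by
  rw [add, toRat_trunc_int hk, toRat_trunc_int hl]
  push_cast
  rfl

theorem relu_trunc_int {p : ℕ} {k : ℤ} (hk : |k| ≤ p) :
    (trunc p (k : ℚ)).relu = trunc p ((max k 0 : ℤ) : ℚ) := by
  rw [relu, toRat_trunc_int hk]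
  push_cast
  rfl

/-- The sum is exact before its single truncation, so only the entries need a bound; a bound on the
result is needed only where it is read back. The equivalence `e` lets coordinates be indexed by
structured types instead of `Fin`. -/
theorem mulVec_trunc_int {p : ℕ} {ι κ κ' : Type*} [Fintype κ] [Fintype κ'] (e : κ' ≃ κ)
    (A : ι → κ → ℤ) (z : κ → ℤ) (i : ι) (hA : ∀ j, |A i j| ≤ p) (hz : ∀ j, |z j| ≤ p) :
    mulVec (fun i j => trunc p (A i (e j) : ℚ)) (fun j => trunc p (z (e j) : ℚ)) i =
      trunc p ((A i ⬝ᵥ z : ℤ) : ℚ) := by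
  have hsum : ∑ j, (trunc p (A i (e j) : ℚ)).toRat * (trunc p (z (e j) : ℚ)).toRat =
      ((A i ⬝ᵥ z : ℤ) : ℚ) := by
    rw [e.sum_comp (fun j => (trunc p (A i j : ℚ)).toRat * (trunc p (z j : ℚ)).toRat), dotProduct]
    push_cast
    exact Finset.sum_congr rfl fun j _ => by rw [toRat_trunc_int (hA j), toRat_trunc_int (hz j)]
  exact congrArg (trunc p) hsum

theorem abs_ite_one_le {p : ℕ} (hp : 1 ≤ p) (P : Prop) [Decidable P] :
    |(if P then 1 else 0 : ℤ)| ≤ p := by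
  split_ifs <;> simp [hp]

theorem isArgmax_oneHot {p : ℕ} (hp : 1 ≤ p) {S : Type*} [DecidableEq S] (o : S) :
    IsArgmax (fun s => trunc p ((if o = s then 1 else 0 : ℤ) : ℚ)) o := by
  intro s hs
  dsimp only
  rw [toRat_trunc_int (abs_ite_one_le hp _), toRat_trunc_int (abs_ite_one_le hp _)]
  simp [Ne.symm hs]

end FixedPoint

/-! ## Transformer layers with integer parameters -/

open scoped Classical in
theorem abs_single_one_le {p : ℕ} {D : Type*} (hp : 1 ≤ p) (c c' : D) : |(Pi.single c 1 : D → ℤ) c'| ≤ p := by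
  rw [Pi.single_apply]
  split_ifs <;> simp [hp]

section IntegerLayers

variable {p : ℕ} {D : Type*} [Fintype D]

/-- The hidden vector with the integer coordinates `z`. -/
noncomputable def intVec (p : ℕ) (z : D → ℤ) : Fin (Fintype.card D) → FixedPoint p :=
  fun c => FixedPoint.trunc p (z ((Fintype.equivFin D).symm c) : ℚ)

theorem intVec_add {z z' : D → ℤ} (h : ∀ c, |z c| ≤ p) (h' : ∀ c, |z' c| ≤ p)
    (c : Fin (Fintype.card D)) :
    (intVec p z c).add (intVec p z' c) = intVec p (fun c => z c + z' c) c :=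
  FixedPoint.add_trunc_int (h _) (h' _)

theorem mulVec_intVec {ι : Type*} (A : ι → D → ℤ) (z : D → ℤ) (i : ι)
    (hA : ∀ j, |A i j| ≤ p) (hz : ∀ j, |z j| ≤ p) :
    FixedPoint.mulVec (fun i => intVec p (A i)) (intVec p z) i =
      FixedPoint.trunc p ((A i ⬝ᵥ z : ℤ) : ℚ) :=
  FixedPoint.mulVec_trunc_int (Fintype.equivFin D).symm A z i hA hz

variable {K : Type*} [Fintype K]

open scoped Classical in
/-- The dense layer that erases the coordinates in `E` and adds each hidden value `ReLU (R z) k`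
to the coordinate `dst k`. -/
noncomputable def updateFF (p : ℕ) (R : K → D → ℤ) (dst : K → D) (E : D → Prop) :
    FeedForward p (Fintype.card D) :=
  .dense (Fintype.card (K ⊕ D))
    (fun h => intVec p
      (Sum.elim R (fun c => Pi.single c 1) ((Fintype.equivFin (K ⊕ D)).symm h) : D → ℤ))
    (fun c => intVec p
      (Sum.elim (fun k => if (Fintype.equivFin D).symm c = dst k then 1 else 0) (fun c' =>
        if (Fintype.equivFin D).symm c = c' ∧ E c' then -1 else 0) : K ⊕ D → ℤ))

theorem updateFF_paramCount (R : K → D → ℤ) (dst : K → D) (E : D → Prop) :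
    (updateFF p R dst E).paramCount =
      2 * ((Fintype.card K + Fintype.card D) * Fintype.card D) := by
  simp [updateFF, FeedForward.paramCount]

open scoped Classical in
-- The units indexed by `D` pass `z` through the rectifier unchanged because `z` is nonnegative;
-- subtracting them is what erases the coordinates in `E` once the residual is added.
theorem updateFF_apply (hp : 1 ≤ p) {R : K → D → ℤ} {dst : K → D} {E : D → Prop}
    {z : D → ℤ} (hR : ∀ k c, |R k c| ≤ p)
    (hz₀ : ∀ c, 0 ≤ z c) (hz₁ : ∀ c, z c ≤ 1) (hRz : ∀ k, |R k ⬝ᵥ z| ≤ p) (c : D) :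
    (updateFF p R dst E).apply (intVec p z) (Fintype.equivFin D c) =
      FixedPoint.trunc p (((∑ k, if c = dst k then max (R k ⬝ᵥ z) 0 else 0) - if E c then z c else 0 : ℤ) : ℚ) := by
  have hp' : (1 : ℤ) ≤ p := by exact_mod_cast hp
  have hz : ∀ c, |z c| ≤ p := fun c => by rw [abs_of_nonneg (hz₀ c)]; exact (hz₁ c).trans hp'
  set hid : K ⊕ D → ℤ := Sum.elim (fun k => max (R k ⬝ᵥ z) 0) z with hhid
  have h₁ : (fun h => FixedPoint.relu (FixedPoint.mulVec (fun h => intVec p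
      (Sum.elim R (fun c => Pi.single c 1) ((Fintype.equivFin (K ⊕ D)).symm h) : D → ℤ))
      (intVec p z) h)) = intVec p hid := by
    funext h
    rw [mulVec_intVec _ _ _ _ hz]
    · unfold intVec
      generalize (Fintype.equivFin (K ⊕ D)).symm h = h'
      rcases h' with k | c
      · simp only [Sum.elim_inl, hhid]
        rw [FixedPoint.relu_trunc_int (hRz k)]
      · simp only [Sum.elim_inr, hhid, single_one_dotProduct]
        rw [FixedPoint.relu_trunc_int (hz c), max_eq_left (hz₀ c)]
    · intro j
      generalize (Fintype.equivFin (K ⊕ D)).symm h = h'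
      rcases h' with k | c
      · exact hR k j
      · simp only [Sum.elim_inr, Pi.single_apply]
        split_ifs <;> simp [hp]
  change FixedPoint.mulVec _ (fun h => FixedPoint.relu (FixedPoint.mulVec _ _ h)) _ = _
  rw [h₁, mulVec_intVec]
  · congr 2
    simp only [dotProduct, Fintype.sum_sum_type, hhid, Sum.elim_inl, Sum.elim_inr,
      Equiv.symm_apply_apply]
    rw [sub_eq_add_neg]
    congr 1
    · simp [ite_mul]
    rw [Finset.sum_eq_single c]
    · split_ifs <;> simp_all
    · intro b _ hb
      simp [Ne.symm hb]
    · simp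
  · rintro (k | c')
    · exact FixedPoint.abs_ite_one_le hp _
    · simp only [Sum.elim_inr]
      split_ifs <;> simp [hp]
  · rintro (k | c')
    · simp only [hhid, Sum.elim_inl]
      exact abs_max_le_max_abs_abs.trans (by simpa using hRz k)
    · exact hz c'

open scoped Classical in
-- Reduces a residual feedforward layer to an integer identity. The layer's output is `z' - z`,
-- which lies in `[-1, 1]`, so adding it is exact.
theorem updateFF_residual (hp : 1 ≤ p) {R : K → D → ℤ} {dst : K → D} {E : D → Prop}
    {z z' : D → ℤ} (hR : ∀ k c, |R k c| ≤ p) (hz : ∀ c, z c ∈ Set.Icc 0 1)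
    (hz' : ∀ c, z' c ∈ Set.Icc 0 1) (hRz : ∀ k, |R k ⬝ᵥ z| ≤ p)
    (h : ∀ c, z' c = (∑ k, if c = dst k then max (R k ⬝ᵥ z) 0 else 0) + if E c then 0 else z c) :
    (fun c => (intVec p z c).add ((updateFF p R dst E).apply (intVec p z) c)) = intVec p z' := by
  have hp' : (1 : ℤ) ≤ p := by exact_mod_cast hp
  funext c
  obtain ⟨c, rfl⟩ := (Fintype.equivFin D).surjective c
  have hc : (∑ k, if c = dst k then max (R k ⬝ᵥ z) 0 else 0) - (if E c then z c else 0) =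
      z' c - z c := by
    rw [h c]
    split_ifs <;> ring
  obtain ⟨h₁, h₂⟩ := hz c
  obtain ⟨h₃, h₄⟩ := hz' c
  rw [updateFF_apply hp hR (fun c => (hz c).1) (fun c => (hz c).2) hRz, hc]
  simp only [intVec, Equiv.symm_apply_apply]
  rw [FixedPoint.add_trunc_int (abs_le.2 ⟨by linarith, by linarith⟩)
    (abs_le.2 ⟨by linarith, by linarith⟩)]
  congr 2
  ring

open scoped Classical in
/-- Attention with one head for each `h : H`, that copies the coordinate `src h` of the position
marked by the coordinate `key h` into the coordinate `dst h`; the coordinate `one` is constant. -/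
noncomputable def copySA (p : ℕ) {H : Type*} [Fintype H] (one : D) (key src dst : H → D) :
    SelfAttention p (Fintype.card D) where
  heads := Fintype.card H
  headDim := 1
  Q _ _ := intVec p (Pi.single one 1 : D → ℤ)
  K h _ := intVec p (Pi.single (key ((Fintype.equivFin H).symm h)) 1 : D → ℤ)
  V h _ := intVec p (Pi.single (src ((Fintype.equivFin H).symm h)) 1 : D → ℤ)
  W c h := FixedPoint.trunc p ((if (Fintype.equivFin D).symm c =
    dst ((Fintype.equivFin H).symm h.1) then 1 else 0 : ℤ) : ℚ)

open scoped Classical in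
-- The query is the constant 1, so the score is the key coordinate itself, the indicator of position
-- `at' h`. Saturated attention then averages over that single position.
theorem copySA_apply (hp : 1 ≤ p) {H : Type*} [Fintype H] {one : D} {key src dst : H → D} {n : ℕ}
    {z : Fin n → D → ℤ} {at' : H → Fin n} (hz : ∀ i c, |z i c| ≤ p) (hone : ∀ i, z i one = 1)
    (hkey : ∀ h i, z i (key h) = if i = at' h then 1 else 0) (i : Fin n) (c : D) :
    (copySA p one key src dst).apply (fun i => intVec p (z i)) i (Fintype.equivFin D c) =
      FixedPoint.trunc p ((∑ h, if c = dst h then z (at' h) (src h) else 0 : ℤ) : ℚ) := by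
  set A := copySA p one key src dst with hA
  have hmul : ∀ (c : D) (i : Fin n), FixedPoint.mulVec
      (fun _ : Fin 1 => intVec p (Pi.single c 1 : D → ℤ)) (intVec p (z i)) 0 =
      FixedPoint.trunc p (z i c : ℚ) := fun c i => by
    rw [mulVec_intVec (fun _ => Pi.single c 1) _ _ (fun _ => abs_single_one_le hp _ _) (hz i),
      single_one_dotProduct]
  have hscore : ∀ h i j, (A.score (fun i => intVec p (z i)) h i j).toRat =
      if j = at' ((Fintype.equivFin H).symm h) then 1 else 0 := by
    intro h i j
    change (FixedPoint.trunc p (∑ c : Fin 1, _)).toRat = _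
    rw [Fin.sum_univ_one]
    change (FixedPoint.trunc p ((FixedPoint.mulVec
      (fun _ : Fin 1 => intVec p (Pi.single one 1 : D → ℤ)) (intVec p (z i)) 0).toRat *
      (FixedPoint.mulVec (fun _ : Fin 1 =>
        intVec p (Pi.single (key ((Fintype.equivFin H).symm h)) 1 : D → ℤ))
        (intVec p (z j)) 0).toRat)).toRat = _
    rw [hmul, hmul, FixedPoint.toRat_trunc_int (hz _ _), FixedPoint.toRat_trunc_int (hz _ _),
      hone, hkey, ← Int.cast_mul, FixedPoint.toRat_trunc_int]
    · push_cast; simp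
    · split_ifs <;> simp [hp]
  have htop : ∀ h i, A.top (fun i => intVec p (z i)) h i =
      {at' ((Fintype.equivFin H).symm h)} := by
    intro h i
    ext j
    simp only [SelfAttention.top, hscore, Finset.mem_filter, Finset.mem_univ, true_and,
      Finset.mem_singleton]
    constructor
    · intro hj
      by_contra hne
      have := hj (at' ((Fintype.equivFin H).symm h))
      simp [hne] at this
      linarith
    · rintro rfl k
      by_cases hk : k = at' ((Fintype.equivFin H).symm h) <;> simp [hk]
  have hhead : ∀ hc, A.head (fun i => intVec p (z i)) i hc =
      FixedPoint.trunc p (z (at' ((Fintype.equivFin H).symm hc.1))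
        (src ((Fintype.equivFin H).symm hc.1)) : ℚ) := by
    rintro ⟨h, c⟩
    obtain rfl : c = (0 : Fin 1) := Subsingleton.elim (α := Fin 1) _ _
    rw [SelfAttention.head, htop, Finset.sum_singleton, Finset.card_singleton, Nat.cast_one,
      div_one]
    change FixedPoint.trunc p (FixedPoint.mulVec (fun _ : Fin 1 => intVec p
      (Pi.single (src ((Fintype.equivFin H).symm h)) 1 : D → ℤ)) (intVec p (z _)) 0).toRat = _
    rw [hmul, FixedPoint.toRat_trunc_int (hz _ _)]
  change FixedPoint.mulVec A.W _ _ = _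
  rw [show A.head (fun i => intVec p (z i)) i = _ from funext hhead]
  have := FixedPoint.mulVec_trunc_int (p := p)
    ((Equiv.prodUnique (Fin (Fintype.card H)) (Fin 1)).trans (Fintype.equivFin H).symm)
    (fun (c : Fin (Fintype.card D)) h =>
      if (Fintype.equivFin D).symm c = dst h then (1 : ℤ) else 0)
    (fun h => z (at' h) (src h)) (Fintype.equivFin D c)
    (fun j => by split_ifs <;> simp [hp]) (fun j => hz _ _)
  refine Eq.trans this ?_
  simp [dotProduct, ite_mul]

open scoped Classical in
theorem copySA_residual (hp : 1 ≤ p) {H : Type*} [Fintype H] {one : D} {key src dst : H → D}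
    {n : ℕ} {z z' : Fin n → D → ℤ} {at' : H → Fin n} (hz : ∀ i c, z i c ∈ Set.Icc 0 1)
    (hz' : ∀ i c, z' i c ∈ Set.Icc 0 1) (hone : ∀ i, z i one = 1)
    (hkey : ∀ h i, z i (key h) = if i = at' h then 1 else 0)
    (h : ∀ i c, z' i c = z i c + ∑ h, if c = dst h then z (at' h) (src h) else 0) :
    (fun i c => (intVec p (z i) c).add
      ((copySA p one key src dst).apply (fun i => intVec p (z i)) i c)) =
      fun i => intVec p (z' i) := by
  have hp' : (1 : ℤ) ≤ p := by exact_mod_cast hp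
  have habs : ∀ i c, |z i c| ≤ p := fun i c => abs_le.2 ⟨by linarith [(hz i c).1],
    by linarith [(hz i c).2]⟩
  funext i c
  obtain ⟨c, rfl⟩ := (Fintype.equivFin D).surjective c
  obtain ⟨h₁, h₂⟩ := hz i c
  obtain ⟨h₃, h₄⟩ := hz' i c
  rw [copySA_apply hp habs hone hkey, ← sub_eq_of_eq_add' (h i c)]
  simp only [intVec, Equiv.symm_apply_apply]
  rw [FixedPoint.add_trunc_int (habs _ _) (abs_le.2 ⟨by linarith, by linarith⟩)]
  congr 2
  ring

end IntegerLayers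

/-! ## Synchronous evaluation of a computation graph -/

namespace ComputationGraph

variable {S : Type*} {n m : ℕ} (G : ComputationGraph S n m)

/-- The symbol at each node after `t` synchronous updates of all function nodes, started from the
evaluation on the constant input `σ`. -/
def sweep (x : Fin n → S) (σ : S) : ℕ → G.V → S
  | 0 => Sum.elim x fun a => G.eval (fun _ => σ) (Sum.inr a)
  | t + 1 => Sum.elim x fun a => G.func a fun i => sweep x σ t (G.args a i)

theorem sweep_inl (x : Fin n → S) (σ : S) (t : ℕ) (j : Fin n) :
    G.sweep x σ t (Sum.inl j) = x j := by
  cases t <;> rfl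

/-- All paths from an input node to `v` have length at most `t`. -/
def InputDepthLE (t : ℕ) (v : G.V) : Prop :=
  ∀ l w, G.IsPath l w → (∃ i, w 0 = Sum.inl i) → w (Fin.last l) = v → l ≤ t

variable {G}

theorem IsPath.snoc {l : ℕ} {w : Fin (l + 1) → G.V} (h : G.IsPath l w) {v : G.V}
    (e : G.Edge (w (Fin.last l)) v) : G.IsPath (l + 1) (Fin.snoc w v : Fin (l + 2) → G.V) := by
  intro i
  refine Fin.lastCases ?_ (fun i => ?_) i
  · rw [Fin.succ_last, Fin.snoc_last, Fin.snoc_castSucc]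
    exact e
  · rw [Fin.succ_castSucc, Fin.snoc_castSucc, Fin.snoc_castSucc]
    exact h i

/-- For `t = 0` this says that no input reaches a predecessor of `v`, which is how the constant
nodes are handled. -/
theorem InputDepthLE.length_lt {t : ℕ} {v u : G.V} (h : G.InputDepthLE t v) (e : G.Edge u v)
    {l : ℕ} {w : Fin (l + 1) → G.V} (hw : G.IsPath l w) (h0 : ∃ i, w 0 = Sum.inl i)
    (hl : w (Fin.last l) = u) : l + 1 ≤ t := by
  refine h (l + 1) (Fin.snoc w v : Fin (l + 2) → G.V) (hw.snoc (hl ▸ e)) ?_ (Fin.snoc_last _ _)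
  obtain ⟨i, hi⟩ := h0
  exact ⟨i, by rw [← hi, ← Fin.castSucc_zero, Fin.snoc_castSucc]⟩

theorem InputDepthLE.pred {t : ℕ} {v u : G.V} (h : G.InputDepthLE (t + 1) v) (e : G.Edge u v) :
    G.InputDepthLE t u := fun _ _ hw h0 hl => Nat.le_of_succ_le_succ (h.length_lt e hw h0 hl)

/-- A function node that no input reaches is constant. -/
theorem eval_eq_of_inputDepthLE_zero (x y : Fin n → S) (v : G.V) :
    ∀ a, v = Sum.inr a → G.InputDepthLE 0 v → G.eval x v = G.eval y v := by
  induction v using G.edge_wellFounded.induction with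
  | _ v ih =>
    rintro a rfl h
    rw [eval_node, eval_node]
    congr 1
    funext i
    have e : G.Edge (G.args a i) (Sum.inr a) := ⟨a, i, rfl, rfl⟩
    rcases hu : G.args a i with j | b
    -- An input argument would give a path of length 1 from an input.
    · exact absurd (h.length_lt e (l := 0) (w := fun _ => G.args a i) (fun i => i.elim0)
        ⟨j, hu⟩ rfl) (by omega)
    · rw [← hu]
      exact ih _ e b hu fun l w hw h0 hl => by have := h.length_lt e hw h0 hl; omega

/-- Induction on `t`, since predecessors satisfy the bound for `t - 1`. At `t = 0` the initial
values are right because a function node within the bound does not depend on the input word. -/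
theorem sweep_eq_eval (x : Fin n → S) (σ : S) {t : ℕ} :
    ∀ {v : G.V}, G.InputDepthLE t v → G.sweep x σ t v = G.eval x v := by
  induction t with
  | zero =>
    rintro (j | a) h
    · rw [sweep_inl, eval_input]
    · exact eval_eq_of_inputDepthLE_zero _ _ _ a rfl h
  | succ t ih =>
    rintro (j | a) h
    · rw [sweep_inl, eval_input]
    · rw [eval_node]
      change G.func a _ = _
      congr 1
      funext i
      exact ih (h.pred ⟨a, i, rfl, rfl⟩)

theorem bddAbove_pathLengths (P : (l : ℕ) → (Fin (l + 1) → G.V) → Prop) :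
    BddAbove {l | ∃ w, G.IsPath l w ∧ P l w} :=
  ⟨G.size, fun _ ⟨_, hw, _⟩ => hw.length_le⟩

/-- A copy in layer `t` belongs to a node of depth at most `t`, and `nodeDepth` bounds all paths
into the node, in particular those from inputs. -/
theorem inputDepthLE_of_mem_expandedLayer {t : ℕ} {v : G.V} (h : v ∈ G.expandedLayer t) :
    G.InputDepthLE t v := by
  have hd : G.nodeDepth v ≤ t := by
    rcases h with h | h
    · exact le_of_eq h
    · simp only [Set.mem_iUnion, Set.mem_inter_iff] at h
      obtain ⟨_, _, _, s, hs, hv⟩ := h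
      exact (show G.nodeDepth v = s from hv).trans_le hs
  exact fun l w hw _ hl => (le_csSup (bddAbove_pathLengths fun l w => w (Fin.last l) = v)
    ⟨w, hw, hl⟩).trans hd

theorem inputDepthLE_output (j : Fin m) : G.InputDepthLE G.depth (G.output j) :=
  fun _ w hw h0 hl => le_csSup (bddAbove_pathLengths fun l w =>
    (∃ i, w 0 = Sum.inl i) ∧ ∃ j, w (Fin.last l) = G.output j) ⟨w, hw, h0, j, hl⟩

theorem InputDepthLE.mono {s t : ℕ} (hst : s ≤ t) {v : G.V} (h : G.InputDepthLE s v) :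
    G.InputDepthLE t v := fun l w hw h0 hl => (h l w hw h0 hl).trans hst

theorem depth_le_size : G.depth ≤ G.size :=
  csSup_le' fun _ ⟨_, hw, _⟩ => hw.length_le

/-- Turns the fan-in bound into a bound on the arity, which governs the table size; arguments
without repetition are essential here. -/
theorem inDegree_inr (a : G.N) : G.inDegree (Sum.inr a) = G.arity a := by
  have : G.Pred (Sum.inr a) = Set.range (G.args a) := by
    ext u
    constructor
    · rintro ⟨b, i, hb, rfl⟩
      cases hb
      exact ⟨i, rfl⟩
    · rintro ⟨i, rfl⟩
      exact ⟨a, i, rfl, rfl⟩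
  rw [inDegree, this, ← Set.image_univ, Set.ncard_image_of_injective _ (G.args_injective a),
    Set.ncard_univ, Nat.card_eq_fintype_card, Fintype.card_fin]

variable (G)

/-- The node whose symbol is written to the output block of position `i`. -/
def outNode (i : Fin n) : G.V :=
  -- Positions before the last `m` are never read as output; their input node is an arbitrary
  -- default.
  if h : n - m ≤ i then G.output ⟨i - (n - m), by omega⟩ else Sum.inl i

theorem outNode_output (h : m ≤ n) (j : Fin m) :
    G.outNode ⟨n - m + j, by omega⟩ = G.output j := by
  simp [outNode]

end ComputationGraph

/-! ## The simulating Transformer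

Every position stores the symbols at all nodes, in an embedding of polynomial dimension. Since the
fan-in is bounded, each local function is computed exactly by a lookup table of constantly many
rectified linear units, so that a constant precision suffices. -/

namespace ComputationGraph

variable {S : Type*} {n m : ℕ}

/-- The coordinates of the embedding: a constant, the position, the input symbol at the position,
a buffer for the whole input word, the symbols at the function nodes, and the output symbol. -/
abbrev Coord (S : Type*) {n m : ℕ} (G : ComputationGraph S n m) : Type _ :=
  Unit ⊕ Fin n ⊕ S ⊕ (Fin n × S) ⊕ (G.N × S) ⊕ S

variable (G : ComputationGraph S n m)

/-- The constant coordinate. -/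
abbrev oneC : Coord S G := .inl ()
/-- The coordinate that marks position `j`. -/
abbrev posC (j : Fin n) : Coord S G := .inr (.inl j)
/-- The coordinate of the input symbol `s`. -/
abbrev symC (s : S) : Coord S G := .inr (.inr (.inl s))
/-- The buffer for the `j`-th input symbol. -/
abbrev bufC (js : Fin n × S) : Coord S G := .inr (.inr (.inr (.inl js)))
/-- The coordinates of the symbol at a function node. -/
abbrev valC (as : G.N × S) : Coord S G := .inr (.inr (.inr (.inr (.inl as))))
/-- The coordinate of the output symbol `s`. -/
abbrev outC (s : S) : Coord S G := .inr (.inr (.inr (.inr (.inr s))))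

/-- The coordinates from which the symbol at a node is read within a loop. -/
def nodeC : G.V → S → Coord S G
  | .inl j, s => G.bufC (j, s)
  | .inr a, s => G.valC (a, s)

section Encoding

variable [DecidableEq S]

/-- The hidden vector with position part `u`, input symbol `σ`, buffer `b`, symbols `c` at the
function nodes and output symbol `o`. -/
def encode (u : Fin n → ℤ) (σ : S) (b : Fin n → S → ℤ) (c : G.N → S) (o : S) : Coord S G → ℤ
  | .inl _ => 1
  | .inr (.inl j) => u j
  | .inr (.inr (.inl s)) => if σ = s then 1 else 0
  | .inr (.inr (.inr (.inl (j, s)))) => b j s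
  | .inr (.inr (.inr (.inr (.inl (a, s))))) => if c a = s then 1 else 0
  | .inr (.inr (.inr (.inr (.inr s)))) => if o = s then 1 else 0

theorem ite_mem_Icc (P : Prop) [Decidable P] : (if P then 1 else 0 : ℤ) ∈ Set.Icc 0 1 := by
  split_ifs <;> simp

theorem encode_mem_Icc {u : Fin n → ℤ} {σ : S} {b : Fin n → S → ℤ} {c : G.N → S} {o : S}
    (hu : ∀ j, u j ∈ Set.Icc 0 1) (hb : ∀ j s, b j s ∈ Set.Icc 0 1) (d : Coord S G) :
    G.encode u σ b c o d ∈ Set.Icc 0 1 := by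
  rcases d with _ | j | s | ⟨j, s⟩ | ⟨a, s⟩ | s
  · simp [encode]
  · exact hu j
  · exact ite_mem_Icc _
  · exact hb j s
  · exact ite_mem_Icc _
  · exact ite_mem_Icc _

/-- The indicator of the position `i`. -/
def posVec (i j : Fin n) : ℤ := if i = j then 1 else 0

/-- The buffer that holds the one-hot encodings of the word `x`. -/
def wordVec (x : Fin n → S) (j : Fin n) (s : S) : ℤ := if x j = s then 1 else 0

/-- While the buffer is full, input nodes and function nodes are read uniformly as one-hot blocks.
-/
theorem encode_nodeC (u : Fin n → ℤ) (σ : S) (x : Fin n → S) (c : G.N → S) (o : S) (v : G.V)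
    (s : S) : G.encode u σ (wordVec x) c o (G.nodeC v s) = if Sum.elim x c v = s then 1 else 0 := by
  rcases v with j | a <;> rfl

end Encoding

/-! ### Lookup tables as rectified linear units -/

/-- The entries of the lookup tables of all local functions. -/
abbrev Entry (S : Type*) {n m : ℕ} (G : ComputationGraph S n m) : Type _ :=
  Σ a : G.N, Fin (G.arity a) → S

open scoped Classical in
/-- The hidden unit that tests whether the arguments of a node are the word `y`. -/
noncomputable def entryRow (k : Entry S G) : Coord S G → ℤ :=
  (∑ i, Pi.single (G.nodeC (G.args k.1 i) (k.2 i)) 1) -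
    Pi.single G.oneC ((G.arity k.1 : ℤ) - 1)

/-- The coordinate that a hidden unit of the lookup table activates. -/
def entryDst (k : Entry S G) : Coord S G := G.valC (k.1, G.func k.1 k.2)

/-- The coordinates of the symbols at the function nodes. -/
def IsVal (c : Coord S G) : Prop := ∃ k, c = G.valC k

open scoped Classical in
/-- The hidden unit that tests whether the position is `j` and its output node has symbol `s`. -/
noncomputable def outRow (k : Fin n × S) : Coord S G → ℤ :=
  Pi.single (G.nodeC (G.outNode k.1) k.2) 1 + Pi.single (G.posC k.1) 1 - Pi.single G.oneC 1

/-- The coordinates of the buffer and of the output symbol. -/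
def IsBufOut (c : Coord S G) : Prop := (∃ k, c = G.bufC k) ∨ ∃ s, c = G.outC s

theorem entryRow_dotProduct [Fintype S] (k : Entry S G) (z : Coord S G → ℤ) :
    G.entryRow k ⬝ᵥ z =
      ∑ i, z (G.nodeC (G.args k.1 i) (k.2 i)) - ((G.arity k.1 : ℤ) - 1) * z G.oneC := by
  simp [entryRow, sub_dotProduct, sum_dotProduct, single_dotProduct]

theorem outRow_dotProduct [Fintype S] (k : Fin n × S) (z : Coord S G → ℤ) :
    G.outRow k ⬝ᵥ z = z (G.nodeC (G.outNode k.1) k.2) + z (G.posC k.1) - z G.oneC := by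
  simp [outRow, sub_dotProduct, add_dotProduct, single_dotProduct]

/-- Serves both the weights and the pre-activations of table units. The bound `l + 1` on the
threshold `l - 1` also covers arity 0, where the threshold is `-1`. -/
theorem abs_sum_sub_le {l p : ℕ} (hl : 2 * l + 1 ≤ p) {f : Fin l → ℤ} {r : ℤ}
    (hf : ∀ i, f i ∈ Set.Icc 0 1) (hr : |r| ≤ l + 1) : |∑ i, f i - r| ≤ p := by
  have h0 : 0 ≤ ∑ i, f i := Finset.sum_nonneg fun i _ => (hf i).1
  have h1 : ∑ i, f i ≤ l := by
    simpa using Finset.sum_le_card_nsmul Finset.univ f 1 fun i _ => (hf i).2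
  have hl' : 2 * (l : ℤ) + 1 ≤ p := by exact_mod_cast hl
  rw [abs_le] at hr ⊢
  constructor <;> linarith [hr.1, hr.2]

theorem single_mem_Icc {D : Type*} [DecidableEq D] (c c' : D) :
    (Pi.single c 1 : D → ℤ) c' ∈ Set.Icc 0 1 := by
  rw [Pi.single_apply]
  exact ite_mem_Icc _

theorem abs_arity_sub_one_le (l : ℕ) : |(l : ℤ) - 1| ≤ l + 1 := by
  rw [abs_le]
  constructor <;> linarith [Int.natCast_nonneg l]

theorem abs_entryRow_le {p : ℕ} {k : Entry S G} (hp : 2 * G.arity k.1 + 1 ≤ p) (c : Coord S G) :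
    |G.entryRow k c| ≤ p := by
  classical
  simp only [entryRow, Pi.sub_apply, Finset.sum_apply]
  refine abs_sum_sub_le hp (fun i => ?_) ?_
  · convert single_mem_Icc (G.nodeC (G.args k.1 i) (k.2 i)) c
  · rw [Pi.single_apply]
    split_ifs
    · exact abs_arity_sub_one_le _
    · rw [abs_zero]; positivity

theorem abs_outRow_le {p : ℕ} (hp : 3 ≤ p) (k : Fin n × S) (c : Coord S G) :
    |G.outRow k c| ≤ p := by
  classical
  have h1 := single_mem_Icc (G.nodeC (G.outNode k.1) k.2) c
  have h2 := single_mem_Icc (G.posC k.1) c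
  have h3 := single_mem_Icc G.oneC c
  have hp' : (3 : ℤ) ≤ p := by exact_mod_cast hp
  have : G.outRow k c = (Pi.single (G.nodeC (G.outNode k.1) k.2) 1 : Coord S G → ℤ) c +
      (Pi.single (G.posC k.1) 1 : Coord S G → ℤ) c - (Pi.single G.oneC 1 : Coord S G → ℤ) c := by
    simp only [outRow, Pi.sub_apply, Pi.add_apply]
  rw [this, abs_le]
  simp only [Set.mem_Icc] at h1 h2 h3
  constructor <;> linarith [h1.1, h1.2, h2.1, h2.2, h3.1, h3.2]

/-- A conjunction of `l` tests as a single rectified linear unit. -/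
theorem max_sum_sub_eq {l : ℕ} (P : Fin l → Prop) [DecidablePred P] [Decidable (∀ i, P i)] :
    max (∑ i, (if P i then 1 else 0 : ℤ) - ((l : ℤ) - 1)) 0 = if ∀ i, P i then 1 else 0 := by
  split_ifs with h
  · simp [h]
  · push Not at h
    obtain ⟨i, hi⟩ := h
    have : ∑ i, (if P i then 1 else 0 : ℤ) ≤ l - 1 := by
      have h1 : ∑ j ∈ Finset.univ.erase i, (if P j then 1 else 0 : ℤ) ≤
          (Finset.univ.erase i).card • (1 : ℤ) :=
        Finset.sum_le_card_nsmul _ _ _ fun j _ => (ite_mem_Icc (P j)).2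
      rw [Finset.card_erase_of_mem (Finset.mem_univ i), Finset.card_univ, Fintype.card_fin,
        nsmul_eq_mul, mul_one, Nat.cast_sub (by have := i.2; omega)] at h1
      rw [← Finset.add_sum_erase _ _ (Finset.mem_univ i), if_neg hi]
      simpa using h1
    exact max_eq_right (by linarith)

/-! ### Action of the layers on encoded states -/

variable [Fintype S] [DecidableEq S]

open scoped Classical in
/-- The first feedforward layer updates all function nodes. -/
theorem entry_update {p : ℕ} (hp : ∀ a, 2 * G.arity a + 1 ≤ p) (hp₁ : 1 ≤ p) {u : Fin n → ℤ}
    (hu : ∀ j, u j ∈ Set.Icc 0 1) (σ : S) (x : Fin n → S) (c : G.N → S) (o : S) :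
    (fun d => (intVec p (G.encode u σ (wordVec x) c o) d).add
      ((updateFF p G.entryRow G.entryDst G.IsVal).apply
        (intVec p (G.encode u σ (wordVec x) c o)) d)) =
      intVec p (G.encode u σ (wordVec x)
        (fun a => G.func a fun i => Sum.elim x c (G.args a i)) o) := by
  have hb : ∀ j s, wordVec x j s ∈ Set.Icc 0 1 := fun _ _ => ite_mem_Icc _
  refine updateFF_residual hp₁ (fun k => G.abs_entryRow_le (hp k.1)) (G.encode_mem_Icc hu hb)
    (G.encode_mem_Icc hu hb) (fun k => ?_) (fun d => ?_)
  · rw [entryRow_dotProduct]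
    refine abs_sum_sub_le (hp k.1) (fun _ => G.encode_mem_Icc hu hb _) ?_
    simpa [encode] using abs_arity_sub_one_le _
  · have hk : ∀ k : Entry S G, max (G.entryRow k ⬝ᵥ G.encode u σ (wordVec x) c o) 0 =
        if k.2 = (fun i => Sum.elim x c (G.args k.1 i)) then 1 else 0 := by
      intro k
      rw [entryRow_dotProduct]
      simp only [encode_nodeC]
      change max (_ - _ * 1) 0 = _
      rw [mul_one, max_sum_sub_eq]
      simp only [funext_iff, eq_comm]
    simp only [hk, Fintype.sum_sigma, entryDst]
    -- For each node exactly one table entry matches the stored arguments.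
    have hs : ∀ a : G.N, (∑ y : Fin (G.arity a) → S, if d = G.valC (a, G.func a y) then
        (if y = (fun i => Sum.elim x c (G.args a i)) then (1 : ℤ) else 0) else 0) =
        if d = G.valC (a, G.func a fun i => Sum.elim x c (G.args a i)) then 1 else 0 := by
      intro a
      rw [Finset.sum_eq_single (fun i => Sum.elim x c (G.args a i))]
      · simp
      · intro y _ hy
        simp [hy]
      · simp
    simp only [hs]
    rcases d with _ | j | s | ⟨j, s⟩ | ⟨a, s⟩ | s
    · simp [encode, IsVal]
    · simp [encode, IsVal]
    · simp [encode, IsVal]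
    · simp [encode, IsVal]
    · simp [encode, IsVal, ite_and, eq_comm]
    · simp [encode, IsVal]

open scoped Classical in
/-- The second feedforward layer writes the output symbols and erases the buffer. -/
theorem out_update {p : ℕ} (hp : 3 ≤ p) (i : Fin n) (σ : S) (x : Fin n → S) (c : G.N → S)
    (o : S) :
    (fun d => (intVec p (G.encode (posVec i) σ (wordVec x) c o) d).add
      ((updateFF p G.outRow (fun k => G.outC k.2) G.IsBufOut).apply
        (intVec p (G.encode (posVec i) σ (wordVec x) c o)) d)) =
      intVec p (G.encode (posVec i) σ 0 c (Sum.elim x c (G.outNode i))) := by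
  have hb : ∀ j s, wordVec x j s ∈ Set.Icc 0 1 := fun _ _ => ite_mem_Icc _
  have hu : ∀ j, posVec i j ∈ Set.Icc 0 1 := fun _ => ite_mem_Icc _
  have hp' : (3 : ℤ) ≤ p := by exact_mod_cast hp
  have hk : ∀ k : Fin n × S, G.outRow k ⬝ᵥ G.encode (posVec i) σ (wordVec x) c o =
      (if Sum.elim x c (G.outNode k.1) = k.2 then 1 else 0) + (if i = k.1 then 1 else 0) - 1 := by
    intro k
    rw [outRow_dotProduct, encode_nodeC]
    rfl
  refine updateFF_residual (by omega) (fun k => G.abs_outRow_le hp k) (G.encode_mem_Icc hu hb)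
    (G.encode_mem_Icc hu fun _ _ => by simp) (fun k => ?_) (fun d => ?_)
  · rw [hk, abs_le]
    split_ifs <;> constructor <;> linarith
  -- Each unit is a conjunction of two tests with threshold 1, and only the unit of position `i` and
  -- its correct symbol fires.
  · have hk' : ∀ k : Fin n × S,
        max (G.outRow k ⬝ᵥ G.encode (posVec i) σ (wordVec x) c o) 0 =
        if k = (i, Sum.elim x c (G.outNode i)) then 1 else 0 := by
      rintro ⟨j, s⟩
      rw [hk]
      by_cases h : i = j
      · subst h
        by_cases h' : Sum.elim x c (G.outNode i) = s
        · simp [h']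
        · simp [h', Ne.symm h']
      · simp only [h, Prod.mk.injEq, Ne.symm h, false_and, if_false]
        split_ifs <;> simp
    simp only [hk']
    rw [Finset.sum_eq_single (i, Sum.elim x c (G.outNode i)) (fun y _ hy => by simp [hy])
      (by simp)]
    rcases d with _ | j | s | ⟨j, s⟩ | ⟨a, s⟩ | s
    · simp [encode, IsBufOut]
    · simp [encode, IsBufOut]
    · simp [encode, IsBufOut]
    · simp [encode, IsBufOut]
    · simp [encode, IsBufOut]
    · simp [encode, IsBufOut, eq_comm]

/-- The first attention layer copies the input word into the buffers of all positions. -/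
theorem word_copy {p : ℕ} (hp : 1 ≤ p) (x : Fin n → S) (c : Fin n → G.N → S) (o : Fin n → S) :
    (fun i d => (intVec p (G.encode (posVec i) (x i) 0 (c i) (o i)) d).add
      ((copySA p G.oneC (fun k : Fin n × S => G.posC k.1) (fun k => G.symC k.2) G.bufC).apply
        (fun i => intVec p (G.encode (posVec i) (x i) 0 (c i) (o i))) i d)) =
      fun i => intVec p (G.encode (posVec i) (x i) (wordVec x) (c i) (o i)) := by
  have hu : ∀ i j : Fin n, posVec i j ∈ Set.Icc 0 1 := fun _ _ => ite_mem_Icc _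
  refine copySA_residual hp (at' := fun k => k.1)
    (fun i => G.encode_mem_Icc (hu i) fun _ _ => by simp)
    (fun i => G.encode_mem_Icc (hu i) fun _ _ => ite_mem_Icc _) (fun _ => rfl)
    (fun _ _ => rfl) (fun i d => ?_)
  rcases d with _ | j | s | ⟨j, s⟩ | ⟨a, s⟩ | s
  · simp [encode]
  · simp [encode]
  · simp [encode]
  · simp only [encode, Pi.zero_apply, zero_add, Sum.inr.injEq, Sum.inl.injEq]
    rw [Finset.sum_eq_single (j, s)]
    · simp [wordVec]
    · intro k _ hk
      simp [Ne.symm hk]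
    · simp
  · simp [encode]
  · simp [encode]

end ComputationGraph

/-! ### The simulating model and its state after each loop -/

namespace ComputationGraph

variable {S : Type*} [Fintype S] [DecidableEq S] {n m : ℕ} (G : ComputationGraph S n m)

open scoped Classical in
/-- The Looped Transformer that performs a synchronous update of all nodes of `G` per loop. -/
noncomputable def loopedTF (p : ℕ) : LoopedTF S p where
  d := Fintype.card (Coord S G)
  -- A position initially knows only its own symbol, so it evaluates the graph on the constant word
  -- of that symbol.
  WE σ := intVec p (G.encode 0 σ 0 (fun a => G.eval (fun _ => σ) (Sum.inr a)) σ)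
  -- The marker is added in loop 0 only: no layer erases it.
  PE i k := intVec p (Sum.elim 0 (Sum.elim (fun j => if k = 0 ∧ i = j then 1 else 0) 0) :
    Coord S G → ℤ)
  layers := [
    (copySA p G.oneC (fun k : Fin n × S => G.posC k.1) (fun k => G.symC k.2) G.bufC,
      updateFF p G.entryRow G.entryDst G.IsVal),
    -- A second feedforward layer must come with an attention layer; this one has no heads.
    (copySA p G.oneC (Empty.elim : Empty → Coord S G) Empty.elim Empty.elim,
      updateFF p G.outRow (fun k => G.outC k.2) G.IsBufOut)]
  γ s := intVec p (Pi.single (G.outC s) 1 : Coord S G → ℤ)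

/-- The output symbol stored at position `i` after `t` loops. -/
def storedOutput (x : Fin n → S) (i : Fin n) : ℕ → S
  | 0 => x i
  | t + 1 => G.sweep x (x i) (t + 1) (G.outNode i)

variable {G}

theorem layerMap_eq {p d N : ℕ} {l : SelfAttention p d × FeedForward p d}
    {z y w : Fin N → Fin d → FixedPoint p} (hy : (fun i c => (z i c).add (l.1.apply z i c)) = y)
    (hw : ∀ i, (fun c => (y i c).add (l.2.apply (y i) c)) = w i) :
    LoopedTF.layerMap l z = w := by
  subst hy
  exact funext hw

/-- The second attention layer is zero. -/
theorem empty_copy {S : Type*} [Fintype S] {G : ComputationGraph S n m} {p : ℕ} (hp : 1 ≤ p) {z : Fin n → Coord S G → ℤ}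
    (hz : ∀ i c, z i c ∈ Set.Icc 0 1) (hone : ∀ i, z i G.oneC = 1) :
    (fun i d => (intVec p (z i) d).add
      ((copySA p G.oneC (Empty.elim : Empty → Coord S G) Empty.elim Empty.elim).apply
        (fun i => intVec p (z i)) i d)) = fun i => intVec p (z i) :=
  copySA_residual hp (at' := Empty.elim) hz hz hone (fun h => h.elim) fun _ _ => by simp

/-- The loop invariant. Each position runs its own sweep, seeded with its own symbol; the buffer is
empty at loop boundaries, so that the residual copy of the next loop starts from zero. -/
theorem loopedTF_state {p : ℕ} (hp : ∀ a, 2 * G.arity a + 1 ≤ p) (hp₃ : 3 ≤ p) (x : Fin n → S)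
    (t : ℕ) (i : Fin n) :
    (G.loopedTF p).state x t i = intVec p (G.encode (if t = 0 then 0 else posVec i) (x i) 0
      (fun a => G.sweep x (x i) t (Sum.inr a)) (G.storedOutput x i t)) := by
  have hp₁ : 1 ≤ p := by omega
  induction t generalizing i with
  | zero => rfl
  | succ t ih =>
    have hpe : (fun i c => ((G.loopedTF p).state x t i c).add ((G.loopedTF p).PE i t c)) =
        fun i => intVec p (G.encode (posVec i) (x i) 0
          (fun a => G.sweep x (x i) t (Sum.inr a)) (G.storedOutput x i t)) := by
      funext i c
      rw [ih i]
      have hu : ∀ j, (if t = 0 then 0 else posVec i : Fin n → ℤ) j ∈ Set.Icc 0 1 := fun j => by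
        split_ifs
        · simp
        · exact ite_mem_Icc _
      have habs : ∀ z : ℤ, z ∈ Set.Icc 0 1 → |z| ≤ p := fun z hz => by
        have : (1 : ℤ) ≤ p := by exact_mod_cast hp₁
        exact abs_le.2 ⟨by linarith [hz.1], by linarith [hz.2]⟩
      refine (intVec_add (fun d => habs _ (G.encode_mem_Icc hu (fun _ _ => by simp) d))
        (fun d => habs _ ?_) c).trans ?_
      · rcases d with _ | j | d
        · simp
        · exact ite_mem_Icc _
        · simp
      · congr 1
        funext d
        rcases d with _ | j | s | ⟨j, s⟩ | ⟨a, s⟩ | s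
        · simp [encode]
        · by_cases ht : t = 0 <;> simp [encode, ht, posVec, Fin.ext_iff]
        · simp [encode]
        · simp [encode]
        · simp [encode]
        · simp [encode]
    change (G.loopedTF p).block _ i = _
    rw [hpe]
    change LoopedTF.layerMap _ (LoopedTF.layerMap _ _) i = _
    have h₁ : LoopedTF.layerMap (copySA p G.oneC (fun k : Fin n × S => G.posC k.1)
          (fun k => G.symC k.2) G.bufC, updateFF p G.entryRow G.entryDst G.IsVal)
        (fun i => intVec p (G.encode (posVec i) (x i) 0
          (fun a => G.sweep x (x i) t (Sum.inr a)) (G.storedOutput x i t))) =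
        fun i => intVec p (G.encode (posVec i) (x i) (wordVec x)
          (fun a => G.sweep x (x i) (t + 1) (Sum.inr a)) (G.storedOutput x i t)) := by
      refine layerMap_eq (G.word_copy hp₁ x _ _) fun i => ?_
      refine (G.entry_update hp hp₁ (fun _ => ite_mem_Icc _) _ _ _ _).trans ?_
      congr 2
      funext a
      change _ = G.func a _
      congr 1
      funext k
      rcases G.args a k with j | b
      · exact (G.sweep_inl x _ t j).symm
      · rfl
    have hb : ∀ i d, G.encode (posVec i) (x i) (wordVec x)
        (fun a => G.sweep x (x i) (t + 1) (Sum.inr a)) (G.storedOutput x i t) d ∈ Set.Icc 0 1 :=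
      fun i d => G.encode_mem_Icc (fun _ => ite_mem_Icc _) (fun _ _ => ite_mem_Icc _) d
    have h₂ : LoopedTF.layerMap (copySA p G.oneC (Empty.elim : Empty → Coord S G) Empty.elim
          Empty.elim, updateFF p G.outRow (fun k => G.outC k.2) G.IsBufOut)
        (fun i => intVec p (G.encode (posVec i) (x i) (wordVec x)
          (fun a => G.sweep x (x i) (t + 1) (Sum.inr a)) (G.storedOutput x i t))) =
        fun i => intVec p (G.encode (posVec i) (x i) 0
          (fun a => G.sweep x (x i) (t + 1) (Sum.inr a)) (G.storedOutput x i (t + 1))) := by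
      have hc := empty_copy hp₁ hb fun _ => rfl
      refine layerMap_eq hc fun i => ?_
      refine (G.out_update hp₃ i _ _ _ _).trans ?_
      congr 2
    exact congrFun ((congrArg (LoopedTF.layerMap _) h₁).trans h₂) i

theorem isArgmax_intVec {S : Type*} [DecidableEq S] {p : ℕ} (hp : 1 ≤ p) {D : Type*} [Fintype D] {z : D → ℤ} {dst : S → D}
    {o : S} (h : ∀ s, z (dst s) = if o = s then 1 else 0) :
    FixedPoint.IsArgmax (fun s => intVec p z (Fintype.equivFin D (dst s))) o := by
  have := FixedPoint.isArgmax_oneHot hp o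
  simpa only [intVec, Equiv.symm_apply_apply, h] using this

theorem loopedTF_γ {p : ℕ} (hp : 1 ≤ p) {z : Coord S G → ℤ} (hz : ∀ c, z c ∈ Set.Icc 0 1) {o : S}
    (h : ∀ s, z (G.outC s) = if o = s then 1 else 0) :
    FixedPoint.IsArgmax (FixedPoint.mulVec (G.loopedTF p).γ (intVec p z)) o := by
  classical
  have h1 : (1 : ℤ) ≤ p := by exact_mod_cast hp
  have hγ : FixedPoint.mulVec (G.loopedTF p).γ (intVec p z) =
      fun s => FixedPoint.trunc p ((if o = s then 1 else 0 : ℤ) : ℚ) := by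
    funext s
    refine (mulVec_intVec _ z s (fun d => abs_single_one_le hp _ d)
      (fun d => abs_le.2 ⟨by linarith [(hz d).1], by linarith [(hz d).2]⟩)).trans ?_
    rw [single_one_dotProduct, h]
  rw [hγ]
  exact FixedPoint.isArgmax_oneHot hp o

theorem loopedTF_outputs {p : ℕ} (hp : ∀ a, 2 * G.arity a + 1 ≤ p) (hp₃ : 3 ≤ p) (hm : m ≤ n)
    (x : Fin n → S) : (G.loopedTF p).Outputs hm (max 1 G.depth) x (G.compute x) := by
  intro j
  -- Output coordinates are first written at the end of a loop, hence at least one loop is needed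
  -- even at depth 0.
  obtain ⟨t, ht⟩ : ∃ t, max 1 G.depth = t + 1 := ⟨max 1 G.depth - 1, by omega⟩
  have hd := (inputDepthLE_output j).mono (le_max_right 1 G.depth)
  rw [ht] at hd ⊢
  rw [loopedTF_state hp hp₃, if_neg (Nat.succ_ne_zero t)]
  refine loopedTF_γ (by omega) (G.encode_mem_Icc (fun _ => ite_mem_Icc _) fun _ _ => by simp)
    fun s => ?_
  change (if G.sweep x _ (t + 1) (G.outNode ⟨n - m + j, _⟩) = s then (1 : ℤ) else 0) = _
  rw [G.outNode_output hm j, sweep_eq_eval x _ hd]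
  rfl

/-- Between loops the buffer is empty, so an input node is read at its own position; a function node
can be read at any position, here position 0. -/
theorem loopedTF_node {p : ℕ} (hp : ∀ a, 2 * G.arity a + 1 ≤ p) (hp₃ : 3 ≤ p) (hn : 0 < n)
    {t : ℕ} {u : G.V} (hu : G.InputDepthLE t u) :
    ∃ (i : Fin n) (slot : S → Fin (G.loopedTF p).d), ∀ x : Fin n → S,
      FixedPoint.IsArgmax (fun s => (G.loopedTF p).state x t i (slot s)) (G.eval x u) := by
  have hp₁ : 1 ≤ p := by omega
  rcases u with j | a
  · refine ⟨j, fun s => Fintype.equivFin (Coord S G) (G.symC s), fun x => ?_⟩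
    rw [loopedTF_state hp hp₃, eval_input]
    exact isArgmax_intVec hp₁ fun s => rfl
  · refine ⟨⟨0, hn⟩, fun s => Fintype.equivFin (Coord S G) (G.valC (a, s)), fun x => ?_⟩
    rw [loopedTF_state hp hp₃, ← sweep_eq_eval x (x ⟨0, hn⟩) hu]
    exact isArgmax_intVec hp₁ fun s => rfl

end ComputationGraph

/-! ## Parameter count -/

namespace IsPolyBounded

theorem mono {f g : ℕ → ℕ} (hg : IsPolyBounded g) (h : ∀ n, f n ≤ g n) : IsPolyBounded f := by
  obtain ⟨k, c, hk⟩ := hg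
  exact ⟨k, c, fun n hn => (h n).trans (hk n hn)⟩

theorem const (c : ℕ) : IsPolyBounded fun _ => c := ⟨0, c, fun n _ => by simp⟩

theorem id : IsPolyBounded fun n => n := ⟨1, 1, fun n _ => by simp⟩

theorem add {f g : ℕ → ℕ} (hf : IsPolyBounded f) (hg : IsPolyBounded g) :
    IsPolyBounded fun n => f n + g n := by
  obtain ⟨k, c, hk⟩ := hf
  obtain ⟨l, d, hl⟩ := hg
  refine ⟨k + l, c + d, fun n hn => ?_⟩
  calc f n + g n ≤ c * n ^ k + d * n ^ l := add_le_add (hk n hn) (hl n hn)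
    _ ≤ c * n ^ (k + l) + d * n ^ (k + l) := by
      gcongr <;> first | exact hn | omega
    _ = (c + d) * n ^ (k + l) := by ring

theorem mul {f g : ℕ → ℕ} (hf : IsPolyBounded f) (hg : IsPolyBounded g) :
    IsPolyBounded fun n => f n * g n := by
  obtain ⟨k, c, hk⟩ := hf
  obtain ⟨l, d, hl⟩ := hg
  refine ⟨k + l, c * d, fun n hn => ?_⟩
  calc f n * g n ≤ (c * n ^ k) * (d * n ^ l) := Nat.mul_le_mul (hk n hn) (hl n hn)
    _ = c * d * n ^ (k + l) := by ring

end IsPolyBounded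

namespace ComputationGraph

variable {S : Type*} [Fintype S] {n m : ℕ} {G : ComputationGraph S n m}

/-- Bounded fan-in makes the tables polynomial. The base `Fintype.card S + 1` is positive even for
an empty alphabet, so powers are monotone in the exponent. -/
theorem card_entry_le {k : ℕ} (hk : ∀ a, G.arity a ≤ k) :
    Fintype.card (Entry S G) ≤ G.size * (Fintype.card S + 1) ^ k := by
  rw [Fintype.card_sigma]
  calc ∑ a : G.N, Fintype.card (Fin (G.arity a) → S)
      ≤ ∑ _a : G.N, (Fintype.card S + 1) ^ k := Finset.sum_le_sum fun a _ => by
        rw [Fintype.card_fun, Fintype.card_fin]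
        exact (Nat.pow_le_pow_left (Nat.le_succ _) _).trans
          (Nat.pow_le_pow_right (Nat.succ_pos _) (hk a))
    _ = Fintype.card G.N * (Fintype.card S + 1) ^ k := by simp
    _ ≤ G.size * (Fintype.card S + 1) ^ k := by
        gcongr
        simp [size]

/-- A bound on the embedding dimension. -/
def dimBound (q N n : ℕ) : ℕ := 1 + n + q + n * q + N * q + q

theorem card_coord_le : Fintype.card (Coord S G) ≤ dimBound (Fintype.card S) G.size n := by
  have : Fintype.card G.N ≤ G.size := by simp [size]
  have := Nat.mul_le_mul_right (Fintype.card S) this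
  simp only [Coord, Fintype.card_sum, Fintype.card_prod, Fintype.card_unit, Fintype.card_fin,
    dimBound]
  omega

/-- A bound on the number of parameters of the simulating Transformer. -/
def paramBound (q k N n : ℕ) : ℕ :=
  q * dimBound q N n + n * (1 + N) * dimBound q N n +
    (4 * (n * q * 1 * dimBound q N n) +
      2 * ((N * (q + 1) ^ k + dimBound q N n) * dimBound q N n) +
      2 * ((n * q + dimBound q N n) * dimBound q N n)) + q * dimBound q N n

theorem loopedTF_paramSize_le [DecidableEq S] {p k : ℕ} (hk : ∀ a, G.arity a ≤ k) :
    (G.loopedTF p).paramSize n (max 1 G.depth) ≤ paramBound (Fintype.card S) k G.size n := by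
  have hd : Fintype.card (Coord S G) ≤ dimBound (Fintype.card S) G.size n := card_coord_le
  have hT : max 1 G.depth ≤ 1 + G.size := by
    have := G.depth_le_size
    omega
  have he := card_entry_le (G := G) hk
  have hs : (G.loopedTF p).paramSize n (max 1 G.depth) =
      Fintype.card S * Fintype.card (Coord S G) +
      n * max 1 G.depth * Fintype.card (Coord S G) +
      (4 * (n * Fintype.card S * 1 * Fintype.card (Coord S G)) +
        2 * ((Fintype.card (Entry S G) + Fintype.card (Coord S G)) * Fintype.card (Coord S G)) +
        2 * ((n * Fintype.card S + Fintype.card (Coord S G)) * Fintype.card (Coord S G))) +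
      Fintype.card S * Fintype.card (Coord S G) := by
    simp only [LoopedTF.paramSize, loopedTF, List.map_cons, List.map_nil, List.sum_cons,
      List.sum_nil, updateFF_paramCount, SelfAttention.paramCount, copySA]
    simp only [Fintype.card_prod, Fintype.card_fin, Fintype.card_empty]
    ring
  -- `paramBound` has the same shape term by term, so monotonicity suffices.
  rw [hs, paramBound]
  gcongr

theorem isPolyBounded_paramBound (q k : ℕ) {N : ℕ → ℕ} (hN : IsPolyBounded N) :
    IsPolyBounded fun n => paramBound q k (N n) n := by
  have hq := IsPolyBounded.const q
  have hi := IsPolyBounded.id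
  have hd : IsPolyBounded fun n => dimBound q (N n) n :=
    (((((IsPolyBounded.const 1).add hi).add hq).add (hi.mul hq)).add (hN.mul hq)).add hq
  exact (((hq.mul hd).add ((hi.mul ((IsPolyBounded.const 1).add hN)).mul hd)).add
    ((((IsPolyBounded.const 4).mul (((hi.mul hq).mul (.const 1)).mul hd)).add
      ((IsPolyBounded.const 2).mul (((hN.mul (.const ((q + 1) ^ k))).add hd).mul hd))).add
      ((IsPolyBounded.const 2).mul (((hi.mul hq).add hd).mul hd)))).add (hq.mul hd)

end ComputationGraph

/-- The threshold is 2 because `Nat.clog 2 n` vanishes for `n ≤ 1`. -/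
theorem isLogPrecision_const (p : ℕ) : IsLogPrecision fun _ => p :=
  ⟨p, 2, fun _ hn => Nat.le_mul_of_pos_right _ (Nat.clog_pos (by norm_num) hn)⟩

/-! ### Assembly -/

theorem mainTheorem1 {S : Type*} [Fintype S] [DecidableEq S] (m : ℕ → ℕ)
    (G : (n : ℕ) → ComputationGraph S n (m n))
    (hsize : IsPolyBounded fun n => (G n).size)
    (happrox : PolyEfficientlyApproximated G)
    (hfanin : BoundedFanIn G)
    (hspace : IsBigONat (fun n => (G n).parallelSpace) fun n => n)
    (hout : ∀ n, m n ≤ n) :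
    ∃ (L : ℕ) (p : ℕ → ℕ) (M : (n : ℕ) → LoopedTF S (p n)) (T : ℕ → ℕ),
      IsLogPrecision p ∧
      (IsPolyBounded fun n => (M n).paramSize n (T n)) ∧
      ∀ n,
        (M n).layers.length = L ∧
        T n = max 1 (G n).depth ∧
        (∀ x : Fin n → S, (M n).Outputs (hout n) (T n) x ((G n).compute x)) ∧
        (0 < n → ∀ t, t ≤ (G n).depth → ∀ u ∈ (G n).expandedLayer t,
          ∃ (i : Fin n) (slot : S → Fin (M n).d), ∀ x : Fin n → S,
            FixedPoint.IsArgmax (fun s => (M n).state x t i (slot s)) ((G n).eval x u)) := by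
  obtain ⟨k, hk⟩ := hfanin
  have hk' : ∀ n a, (G n).arity a ≤ k := fun n a => by
    have := hk n (Sum.inr a)
    rwa [ComputationGraph.inDegree_inr] at this
  -- The precision `2 * k + 3` covers the table units, which need `2 * k + 1`, and the output units,
  -- which need 3 even when `k = 0`.
  have hp : ∀ n a, 2 * (G n).arity a + 1 ≤ 2 * k + 3 := fun n a => by
    have := hk' n a
    omega
  refine ⟨2, fun _ => 2 * k + 3, fun n => (G n).loopedTF (2 * k + 3),
    fun n => max 1 (G n).depth, isLogPrecision_const _,
    (ComputationGraph.isPolyBounded_paramBound (Fintype.card S) k hsize).mono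
      fun n => ComputationGraph.loopedTF_paramSize_le (hk' n), fun n => ⟨rfl, rfl,
    ComputationGraph.loopedTF_outputs (hp n) (by omega) (hout n), fun hn t _ u hu =>
    ComputationGraph.loopedTF_node (hp n) (by omega) hn
      (ComputationGraph.inputDepthLE_of_mem_expandedLayer hu)⟩⟩
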